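/- Let $\mathbf X_1\in\mathbb R^{t_1\times d}$ and $\mathbf X_2\in\mathbb R^{t_2\times d}$ be fixed design matrices, let $\theta_1,\theta_2\in\mathbb R^d$ and $\sigma>0$, and let the entries of $\mathbf y_1\in\mathbb R^{t_1}$ and $\mathbf y_2\in\mathbb R^{t_2}$ be jointly independent Gaussian random variables of variance $\sigma^2$ with $\mathbb E[\mathbf y_1]=\mathbf X_1\theta_1$ and $\mathbb E[\mathbf y_2]=\mathbf X_2\theta_2$. Write $\mathcal H_1=(\mathbf X_1,\mathbf y_1)$, $\mathcal H_2=(\mathbf X_2,\mathbf y_2)$ and $$\mathbf X=\begin{bmatrix}\mathbf X_1\\ \mathbf X_2\end{bmatrix},\qquad \mathbf y=\begin{bmatrix}\mathbf y_1\\ \mathbf y_2\end{bmatrix}.$$ For a matrix $A$ let $A^-$ denote an arbitrary generalized inverse (any matrix with $AA^-A=A$). Put $\vartheta_i=(\mathbf X_i^\top\mathbf X_i)^-\mathbf X_i^\top\mathbf y_i$ for $i=1,2$, $\vartheta_{1,2}=(\mathbf X_1^\top\mathbf X_1+\mathbf X_2^\top\mathbf X_2)^-\mathbf X^\top\mathbf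 y$, and $$s(\mathcal H_1,\mathcal H_2)=\frac{\|\mathbf X_1(\vartheta_1-\vartheta_{1,2})\|^2+\|\mathbf X_2(\vartheta_2-\vartheta_{1,2})\|^2}{\sigma^2}.$$ Let $df=\operatorname{rank}(\mathbf X_1)+\operatorname{rank}(\mathbf X_2)-\operatorname{rank}(\mathbf X)$ and $$\psi=\frac1{\sigma^2}\begin{bmatrix}\mathbf X_1\theta_1\\ \mathbf X_2\theta_2\end{bmatrix}^\top\Bigl[\mathbf I-\mathbf X(\mathbf X_1^\top\mathbf X_1+\mathbf X_2^\top\mathbf X_2)^-\mathbf X^\top\Bigr]\begin{bmatrix}\mathbf X_1\theta_1\\ \mathbf X_2\theta_2\end{bmatrix}.$$ Let $F(\cdot\,;k,\lambda)$ be the cumulative distribution function of the noncentral $\chi^2$ distribution with $k$ degrees of freedom and noncentrality parameter $\lambda$, i.e. of $\sum_{i=1}^k Z_i^2$ with independent $Z_i\sim N(m_i,1)$ and $\sum_i m_i^2=\lambda$ (for $k=0$, $\lambda=0$ it is the point mass at $0$), and let $\lambda_{\min}$ denote the smallest eigenvalue of a symmetric matrix. If $\theta_1\neq\theta_2$, then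 $\psi\ge 0$ and, for every $\upsilon\in\mathbb R$, $$P\bigl(s(\mathcal H_1,\mathcal H_2)\le\upsilon\bigr)\le\begin{cases}F\!\left(\upsilon;\,d,\ \dfrac{\|\theta_1-\theta_2\|^2/\sigma^2}{1/\lambda_{\min}(\mathbf X_1^\top\mathbf X_1)+1/\lambda_{\min}(\mathbf X_2^\top\mathbf X_2)}\right)&\text{if }\mathbf X_1\text{ and }\mathbf X_2\text{ both have full column rank } d,\\[2ex] F(\upsilon;\,df,\,0)&\text{otherwise.}\end{cases}$$ -/

import Mathlib

open MeasureTheory ProbabilityTheory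
open scoped Matrix

noncomputable section

namespace HomogeneityTest

/-- `G` is a generalized inverse `A⁻` of the matrix `A`, i.e. `A A⁻ A = A`. -/
def IsGeneralizedInverse {m n : Type*} [Fintype m] [Fintype n]
    (A : Matrix m n ℝ) (G : Matrix n m ℝ) : Prop :=
  A * G * A = A

/-- The estimator `ϑ = (XᵀX)⁻ Xᵀ y`, where `G` is the chosen generalized inverse of `XᵀX`. -/
def estimator {m n : Type*} [Fintype m] [Fintype n]
    (X : Matrix m n ℝ) (G : Matrix n n ℝ) (y : m → ℝ) : n → ℝ :=
  (G * Xᵀ) *ᵥ y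

/-- The squared Euclidean norm of a vector of real numbers. -/
def sqNorm {m : Type*} [Fintype m] (v : m → ℝ) : ℝ := ‖WithLp.toLp 2 v‖ ^ 2

/-- The test statistic
`s(H₁, H₂) = (‖X₁ (ϑ₁ - ϑ₁₂)‖² + ‖X₂ (ϑ₂ - ϑ₁₂)‖²) / σ²`, where `ϑ₁`, `ϑ₂` are the estimators on
the two data sets and `ϑ₁₂` is the estimator on the pooled data set. The matrices `G₁`, `G₂`, `G₁₂`
are the generalized inverses used in the three estimators. -/
def testStatistic {t₁ t₂ d : ℕ} (σ : ℝ)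
    (X₁ : Matrix (Fin t₁) (Fin d) ℝ) (X₂ : Matrix (Fin t₂) (Fin d) ℝ)
    (G₁ G₂ G₁₂ : Matrix (Fin d) (Fin d) ℝ) (y₁ : Fin t₁ → ℝ) (y₂ : Fin t₂ → ℝ) : ℝ :=
  (sqNorm (X₁ *ᵥ (estimator X₁ G₁ y₁ -
        estimator (Matrix.fromRows X₁ X₂) G₁₂ (Sum.elim y₁ y₂))) +
      sqNorm (X₂ *ᵥ (estimator X₂ G₂ y₂ -
        estimator (Matrix.fromRows X₁ X₂) G₁₂ (Sum.elim y₁ y₂)))) / σ ^ 2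

/-- The degrees of freedom `rank X₁ + rank X₂ - rank [X₁; X₂]`. The subtraction is never truncated
since the rank of the stacked matrix is at most the sum of the ranks. -/
def degreesOfFreedom {t₁ t₂ d : ℕ}
    (X₁ : Matrix (Fin t₁) (Fin d) ℝ) (X₂ : Matrix (Fin t₂) (Fin d) ℝ) : ℕ :=
  X₁.rank + X₂.rank - (Matrix.fromRows X₁ X₂).rank

/-- The noncentrality parameter
`ψ = [X₁θ₁; X₂θ₂]ᵀ (I - [X₁; X₂] (X₁ᵀX₁ + X₂ᵀX₂)⁻ [X₁ᵀ X₂ᵀ]) [X₁θ₁; X₂θ₂] / σ²`,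
where `G₁₂` is the chosen generalized inverse of `X₁ᵀX₁ + X₂ᵀX₂`. -/
def noncentrality {t₁ t₂ d : ℕ} (σ : ℝ)
    (X₁ : Matrix (Fin t₁) (Fin d) ℝ) (X₂ : Matrix (Fin t₂) (Fin d) ℝ)
    (G₁₂ : Matrix (Fin d) (Fin d) ℝ) (θ₁ θ₂ : EuclideanSpace ℝ (Fin d)) : ℝ :=
  (Sum.elim (X₁ *ᵥ θ₁.ofLp) (X₂ *ᵥ θ₂.ofLp) ⬝ᵥ
    ((1 - Matrix.fromRows X₁ X₂ * G₁₂ * (Matrix.fromRows X₁ X₂)ᵀ) *ᵥ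
      Sum.elim (X₁ *ᵥ θ₁.ofLp) (X₂ *ᵥ θ₂.ofLp))) / σ ^ 2

/-- The smallest eigenvalue of a symmetric real matrix of positive size (its spectrum is then a
finite nonempty set of real numbers). -/
def minEigenvalue {d : ℕ} (A : Matrix (Fin d) (Fin d) ℝ) : ℝ := sInf (spectrum ℝ A)

/-- The noncentral chi-squared distribution `χ²(k, ψ)` with `k` degrees of freedom and noncentrality
parameter `ψ ≥ 0`: the law of `∑ i, Zᵢ²` for independent `Zᵢ ∼ N(mᵢ, 1)`, `i < k`, with
`∑ i, mᵢ² = ψ`. By rotation invariance only `ψ` matters, and the mean vector is taken to be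
`(√ψ, 0, …, 0)`. For `k = 0` and `ψ = 0` it is the point mass at `0`. -/
def noncentralChiSquared (k : ℕ) (ψ : ℝ) : Measure ℝ :=
  (Measure.pi fun i : Fin k => gaussianReal (if (i : ℕ) = 0 then √ψ else 0) 1).map
    fun z => ∑ i, z i ^ 2

instance isProbabilityMeasure_noncentralChiSquared (k : ℕ) (ψ : ℝ) :
    IsProbabilityMeasure (noncentralChiSquared k ψ) :=
  Measure.isProbabilityMeasure_map (Measurable.aemeasurable (by fun_prop))

/-- `F(υ; k, ψ)`, the cumulative distribution function of `χ²(k, ψ)` evaluated at `υ`. -/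
def chiSquaredCDF (υ : ℝ) (k : ℕ) (ψ : ℝ) : ℝ := cdf (noncentralChiSquared k ψ) υ

end HomogeneityTest

end

/-! For any generalized inverse `G` of `XᵀX`, the matrix `X G Xᵀ` is the orthogonal projection onto
the range of `X`. The vector whose norm enters the statistic is therefore `Q y`, with `Q` the
projection onto `range X₁ × range X₂` minus the projection onto the range of the stacked matrix. The
second range lies in the first, so `Q` is itself an orthogonal projection, and its rank, read off
from the trace, is `df`. Hence the statistic has exactly the law `χ²(df, ψ)` with `ψ = ‖Q μ‖² / σ² ≥
0`, where `μ` is the mean of `y` (`hasLaw_sqNorm_mulVec_div`, `noncentrality_eq`).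

The CDF of `χ²(k, ψ)` decreases in `ψ` (`chiSquaredCDF_antitone`), so a lower bound on `ψ` suffices.
In general this is `ψ ≥ 0`. With full column ranks, `df = d` and `σ² ψ = ‖X₁(θ₁ - w)‖² + ‖X₂(θ₂ -
w)‖²` for a common `w`; the smallest eigenvalues and a weighted Cauchy–Schwarz inequality bound this
below (`le_noncentrality`). -/

namespace HomogeneityTest

/-! ### Orthogonal projections built from generalized inverses. -/

section LinearAlgebra

variable {m n : Type*} [Fintype m] [Fintype n]

theorem sqNorm_eq_dotProduct (v : m → ℝ) : sqNorm v = v ⬝ᵥ v := by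
  rw [sqNorm, EuclideanSpace.norm_sq_eq]
  simp [dotProduct, sq]

theorem sqNorm_nonneg (v : m → ℝ) : 0 ≤ sqNorm v := by unfold sqNorm; positivity

theorem sqNorm_sumElim (v : m → ℝ) (w : n → ℝ) :
    sqNorm (Sum.elim v w) = sqNorm v + sqNorm w := by
  simp [sqNorm_eq_dotProduct]

/-- `XᵀX B = 0` forces `X B = 0`; take `B = G XᵀX - 1`. -/
theorem IsGeneralizedInverse.mul_mul_transpose_mul_self {X : Matrix m n ℝ} {G : Matrix n n ℝ}
    (h : IsGeneralizedInverse (Xᵀ * X) G) : X * G * Xᵀ * X = X := by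
  classical
  have h1 : Xᵀ * X * (G * (Xᵀ * X) - 1) = 0 := by
    rw [mul_sub, mul_one, ← Matrix.mul_assoc, h, sub_self]
  have h2 := (Matrix.conjTranspose_mul_self_mul_eq_zero X (G * (Xᵀ * X) - 1)).1
    (by simpa [Matrix.conjTranspose_eq_transpose_of_trivial] using h1)
  rw [Matrix.mul_sub, Matrix.mul_one, sub_eq_zero] at h2
  simpa only [Matrix.mul_assoc] using h2

/-- `G` need not be symmetric. For `R = X G Xᵀ`, the identity `R X = X` gives `R Rᵀ = Rᵀ`, and its
transpose gives `R Rᵀ = R`. -/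
theorem IsGeneralizedInverse.transpose_mul_transpose {X : Matrix m n ℝ} {G : Matrix n n ℝ}
    (h : IsGeneralizedInverse (Xᵀ * X) G) : (X * G * Xᵀ)ᵀ = X * G * Xᵀ := by
  have h1 := congrArg Matrix.transpose h.mul_mul_transpose_mul_self
  simp only [Matrix.transpose_mul, Matrix.transpose_transpose] at h1 ⊢
  calc X * (Gᵀ * Xᵀ) = X * G * Xᵀ * X * (Gᵀ * Xᵀ) := by rw [h.mul_mul_transpose_mul_self]
    _ = X * G * (Xᵀ * (X * (Gᵀ * Xᵀ))) := by simp only [Matrix.mul_assoc]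
    _ = X * G * Xᵀ := by rw [h1]

theorem trace_eq_rank_of_isIdempotentElem [DecidableEq n] {Q : Matrix n n ℝ} (h : Q * Q = Q) :
    Q.trace = Q.rank := by
  have hp : LinearMap.IsProj (LinearMap.range (Matrix.toLin' Q)) (Matrix.toLin' Q) := by
    refine ⟨fun x => ⟨x, rfl⟩, ?_⟩
    rintro _ ⟨x, rfl⟩
    simp [Matrix.mulVec_mulVec, h]
  rw [← Matrix.trace_toLin'_eq, hp.trace]
  rfl

theorem IsGeneralizedInverse.trace_eq_rank [DecidableEq m] {X : Matrix m n ℝ} {G : Matrix n n ℝ}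
    (h : IsGeneralizedInverse (Xᵀ * X) G) : (X * G * Xᵀ).trace = X.rank := by
  rw [trace_eq_rank_of_isIdempotentElem]
  · congr 1
    apply le_antisymm
    · rw [Matrix.mul_assoc]; exact Matrix.rank_mul_le_left _ _
    · conv_lhs => rw [← h.mul_mul_transpose_mul_self]
      exact Matrix.rank_mul_le_left _ _
  · rw [← Matrix.mul_assoc, ← Matrix.mul_assoc, h.mul_mul_transpose_mul_self]

/-- The `u i` form an orthonormal basis of the range of `Q` whose first vector points along `Q μ`.
This puts the whole mean in coordinate `0`, as in `noncentralChiSquared`. -/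
theorem exists_orthonormal_sqNorm_mulVec [DecidableEq n] {Q : Matrix n n ℝ} (hs : Qᵀ = Q)
    (hi : Q * Q = Q) {k : ℕ} (hk : Q.rank = k) (μ : n → ℝ) :
    ∃ u : Fin k → n → ℝ, (∀ i j, u i ⬝ᵥ u j = if i = j then 1 else 0) ∧
      (∀ y, sqNorm (Q *ᵥ y) = ∑ i, (u i ⬝ᵥ y) ^ 2) ∧
      ∀ i, u i ⬝ᵥ μ = if (i : ℕ) = 0 then √(sqNorm (Q *ᵥ μ)) else 0 := by
  let T : EuclideanSpace ℝ n →ₗ[ℝ] EuclideanSpace ℝ n := Matrix.toEuclideanLin Q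
  let W := LinearMap.range T
  have hT (x : EuclideanSpace ℝ n) : T x = WithLp.toLp 2 (Q *ᵥ x.ofLp) := rfl
  have hfin : Module.finrank ℝ W = k := by
    rw [← hk, Matrix.rank_eq_finrank_range_toLin Q (PiLp.basisFun 2 ℝ n) (PiLp.basisFun 2 ℝ n)]
    rfl
  let v : W := ⟨T (WithLp.toLp 2 μ), ⟨_, rfl⟩⟩
  have hv : ‖v‖ = √(sqNorm (Q *ᵥ μ)) := by
    rw [sqNorm, Real.sqrt_sq (norm_nonneg _)]; rfl
  have key : ∃ b : OrthonormalBasis (Fin k) ℝ W, ∀ i : Fin k, (i : ℕ) = 0 → v ≠ 0 →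
      b i = ‖v‖⁻¹ • v := by
    obtain ⟨b, hb⟩ := Orthonormal.exists_orthonormalBasis_extension_of_card_eq (𝕜 := ℝ)
      (ι := Fin k) (E := W) (by simp [hfin]) (v := fun _ => ‖v‖⁻¹ • v)
      -- If `Q μ = 0` no vector is prescribed and any basis serves.
      (s := {i | (i : ℕ) = 0 ∧ v ≠ 0}) (by
        constructor
        · rintro ⟨i, hi0, hv0⟩
          simp [norm_smul, hv0]
        · rintro ⟨i, hi0, hv0⟩ ⟨j, hj0, _⟩ hij
          exact absurd (Subtype.ext (Fin.ext (hi0.trans hj0.symm))) hij)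
    exact ⟨b, fun i h0 h1 => hb i ⟨h0, h1⟩⟩
  obtain ⟨b, hb⟩ := key
  have hinner (x y : EuclideanSpace ℝ n) : inner ℝ x y = x.ofLp ⬝ᵥ y.ofLp := by
    rw [EuclideanSpace.inner_eq_star_dotProduct, dotProduct_comm]; rfl
  have hQb (i) : Q *ᵥ (b i : EuclideanSpace ℝ n).ofLp = (b i : EuclideanSpace ℝ n).ofLp := by
    obtain ⟨x, hx⟩ := (b i).2
    rw [← hx, hT]
    simp [Matrix.mulVec_mulVec, hi]
  have hsymm (i) (y : n → ℝ) : (b i : EuclideanSpace ℝ n).ofLp ⬝ᵥ y =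
      (b i : EuclideanSpace ℝ n).ofLp ⬝ᵥ (Q *ᵥ y) := by
    rw [Matrix.dotProduct_mulVec, ← Matrix.mulVec_transpose, hs, hQb]
  refine ⟨fun i => (b i : EuclideanSpace ℝ n).ofLp, fun i j => ?_, fun y => ?_, fun i => ?_⟩
  · rw [← hinner]
    exact orthonormal_iff_ite.1 b.orthonormal i j
  · have := b.sum_sq_norm_inner_right ⟨T (WithLp.toLp 2 y), ⟨_, rfl⟩⟩
    calc sqNorm (Q *ᵥ y) = ‖(⟨T (WithLp.toLp 2 y), ⟨_, rfl⟩⟩ : W)‖ ^ 2 := rfl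
      _ = _ := this.symm
      _ = _ := by
        refine Finset.sum_congr rfl fun i _ => ?_
        rw [Real.norm_eq_abs, sq_abs, hsymm]
        congr 1
        exact hinner _ _
  · have h1 : (b i : EuclideanSpace ℝ n).ofLp ⬝ᵥ μ = inner ℝ (b i) v := by
      rw [hsymm]; exact (hinner (b i) v).symm
    rw [h1, ← hv]
    by_cases hv0 : v = 0
    · simp [hv0]
    have hk0 : 0 < k := i.pos
    have hb0 := hb ⟨0, hk0⟩ rfl hv0
    have hvb : v = ‖v‖ • b ⟨0, hk0⟩ := by
      rw [hb0, smul_smul, mul_inv_cancel₀ (norm_ne_zero_iff.2 hv0), one_smul]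
    have h2 : inner ℝ (b i) v = ‖v‖ * inner ℝ (b i) (b ⟨0, hk0⟩) := by
      conv_lhs => rw [hvb]
      exact real_inner_smul_right (b i : EuclideanSpace ℝ n) (b ⟨0, hk0⟩ : EuclideanSpace ℝ n) ‖v‖
    rw [h2, orthonormal_iff_ite.1 b.orthonormal]
    simp [Fin.ext_iff]

end LinearAlgebra

/-! ### Gaussian coordinates and monotonicity in the noncentrality. -/

section Probability

/-- The coordinates are jointly Gaussian with identity covariance by orthonormality, and
uncorrelated jointly Gaussian variables are independent. -/
theorem hasLaw_dotProduct_div {Ω n κ : Type*} [MeasurableSpace Ω] {P : Measure Ω}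
    [IsProbabilityMeasure P] [Fintype n] [Fintype κ] [DecidableEq κ] {σ : ℝ} (hσ : 0 < σ)
    {μ : n → ℝ} {y : n → Ω → ℝ}
    (hy : ∀ i, HasLaw (y i) (gaussianReal (μ i) (σ ^ 2).toNNReal) P) (hind : iIndepFun y P)
    {u : κ → n → ℝ} (hu : ∀ i j, u i ⬝ᵥ u j = if i = j then 1 else 0) :
    HasLaw (fun ω i => (u i ⬝ᵥ fun j => y j ω) / σ)
      (Measure.pi fun i => gaussianReal ((u i ⬝ᵥ μ) / σ) 1) P := by
  classical
  have hg : HasGaussianLaw (fun ω i => y i ω) P := hind.hasGaussianLaw fun i => (hy i).hasGaussianLaw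
  have hmem (i) : MemLp (y i) 2 P := (hy i).hasGaussianLaw.memLp_two
  have hcov (i j) : cov[y i, y j; P] = if i = j then σ ^ 2 else 0 := by
    split_ifs with h
    · subst h
      rw [covariance_self (hy i).aemeasurable, (hy i).variance_eq, variance_id_gaussianReal,
        Real.coe_toNNReal _ (sq_nonneg σ)]
    · exact (hind.indepFun h).covariance_eq_zero (hmem i) (hmem j)
  have hint (i) : ∫ ω, y i ω ∂P = μ i := by
    rw [(hy i).integral_eq, integral_id_gaussianReal]
  let Z : κ → Ω → ℝ := fun i ω => (u i ⬝ᵥ fun j => y j ω) / σ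
  let L : (n → ℝ) →L[ℝ] (κ → ℝ) :=
    ContinuousLinearMap.pi fun i => ∑ j, (u i j / σ) • ContinuousLinearMap.proj j
  have hZL (ω) : (fun i => Z i ω) = L (fun j => y j ω) := by
    ext i
    simp [Z, L, dotProduct, Finset.sum_div, div_mul_eq_mul_div]
  have hZg : HasGaussianLaw (fun ω i => Z i ω) P := by
    rw [funext hZL]
    exact hg.map_fun L
  have hZs (i) : Z i = fun ω => ∑ j, (u i j / σ) * y j ω := by
    ext ω
    simp [Z, dotProduct, Finset.sum_div, div_mul_eq_mul_div]
  have hZcov (i j) : cov[Z i, Z j; P] = if i = j then 1 else 0 := by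
    rw [hZs, hZs, covariance_fun_sum_fun_sum (fun a => (hmem a).const_mul _)
      (fun a => (hmem a).const_mul _)]
    simp_rw [covariance_const_mul_left, covariance_const_mul_right, hcov]
    rw [← hu i j]
    simp only [mul_ite, mul_zero, Finset.sum_ite_eq, Finset.mem_univ, if_true, dotProduct]
    refine Finset.sum_congr rfl fun a _ => ?_
    field_simp
  have hZind : iIndepFun Z P :=
    hZg.iIndepFun_of_covariance_eq_zero fun i j hij => by simp [hZcov, hij]
  refine hZind.hasLaw_pi fun i => ⟨(hZg.eval i).aemeasurable, ?_⟩
  rw [(hZg.eval i).map_eq_gaussianReal]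
  congr 1
  · rw [hZs, integral_finsetSum _ fun a _ => ((hmem a).integrable one_le_two).const_mul _]
    simp_rw [integral_const_mul, hint]
    simp [dotProduct, Finset.sum_div, div_mul_eq_mul_div]
  · rw [← covariance_self (hZg.eval i).aemeasurable, hZcov]
    simp

theorem gaussianPDF_le_gaussianPDF {a b x : ℝ} (v : NNReal) (hab : a ≤ b) (hx : 2 * x ≤ a + b) :
    gaussianPDF b v x ≤ gaussianPDF a v x := by
  unfold gaussianPDF gaussianPDFReal
  gcongr ENNReal.ofReal (_ * Real.exp (?_ / _))
  nlinarith

/-- The reflection `x ↦ a + b - x` exchanges the two Gaussians and the intervals `I = [-r, r]` and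
`J = [a + b - r, a + b + r]`. Thus `I ∩ J` has the same mass under both, while `I \ J` lies on the
side of the midpoint where the density centred at `a` is the larger. -/
theorem gaussianReal_Icc_antitone {a b r : ℝ} (ha : 0 ≤ a) (hab : a ≤ b) :
    gaussianReal b 1 (Set.Icc (-r) r) ≤ gaussianReal a 1 (Set.Icc (-r) r) := by
  have hJ : MeasurableSet (Set.Icc (a + b - r) (a + b + r)) := measurableSet_Icc
  rw [← measure_inter_add_sdiff (Set.Icc (-r) r) hJ,
    ← measure_inter_add_sdiff (μ := gaussianReal a 1) (Set.Icc (-r) r) hJ]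
  refine add_le_add (le_of_eq ?_) ?_
  · have h : gaussianReal b 1 = (gaussianReal a 1).map (fun x => (a + b) - x) := by
      rw [gaussianReal_map_const_sub, add_sub_cancel_left]
    rw [h, Measure.map_apply (by fun_prop) (measurableSet_Icc.inter hJ)]
    congr 1
    ext x
    simp only [Set.mem_preimage, Set.mem_inter_iff, Set.mem_Icc]
    grind
  · rw [gaussianReal_apply _ one_ne_zero, gaussianReal_apply _ one_ne_zero]
    refine setLIntegral_mono' (measurableSet_Icc.diff hJ) fun x hx => ?_
    -- Outside `J` but in `I`, both `x < a + b - r` and `x ≤ r` hold; their sum gives `2x ≤ a + b`.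
    refine gaussianPDF_le_gaussianPDF 1 hab ?_
    simp only [Set.mem_sdiff, Set.mem_Icc] at hx
    grind

theorem gaussianReal_sq_le_antitone {a b : ℝ} (ha : 0 ≤ a) (hab : a ≤ b) (c : ℝ) :
    gaussianReal b 1 {x | x ^ 2 ≤ c} ≤ gaussianReal a 1 {x | x ^ 2 ≤ c} := by
  by_cases hc : 0 ≤ c
  · have h : {x : ℝ | x ^ 2 ≤ c} = Set.Icc (-√c) √c := by
      ext x
      rw [Set.mem_ofPred_eq, Real.sq_le hc, Set.mem_Icc]
    rw [h]
    exact gaussianReal_Icc_antitone ha hab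
  · have h : {x : ℝ | x ^ 2 ≤ c} = ∅ := by
      ext x
      simp only [Set.mem_ofPred_eq, Set.mem_empty_iff_false, iff_false]
      nlinarith [sq_nonneg x]
    simp [h]

/-- Conditioning on the centred coordinates isolates the only one that depends on `ψ`, reducing
monotonicity to dimension one. -/
theorem noncentralChiSquared_Iic_succ (υ ψ : ℝ) (k : ℕ) :
    noncentralChiSquared (k + 1) ψ (Set.Iic υ) =
      ∫⁻ w, gaussianReal √ψ 1 {x | x ^ 2 ≤ υ - ∑ i, w i ^ 2}
        ∂(Measure.pi fun _ : Fin k => gaussianReal 0 1) := by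
  have hmp := (measurePreserving_piFinSuccAbove
    (fun i : Fin (k + 1) => gaussianReal (if (i : ℕ) = 0 then √ψ else 0) 1) 0)
  have hS : MeasurableSet {p : ℝ × (Fin k → ℝ) | p.1 ^ 2 ≤ υ - ∑ i, p.2 i ^ 2} :=
    measurableSet_le (by fun_prop) (by fun_prop)
  rw [noncentralChiSquared, Measure.map_apply (by fun_prop) measurableSet_Iic]
  have hpre : (fun z : Fin (k + 1) → ℝ => ∑ i, z i ^ 2) ⁻¹' Set.Iic υ =
      MeasurableEquiv.piFinSuccAbove (fun _ : Fin (k + 1) => ℝ) 0 ⁻¹'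
        {p : ℝ × (Fin k → ℝ) | p.1 ^ 2 ≤ υ - ∑ i, p.2 i ^ 2} := by
    ext z
    simp [Fin.sum_univ_succ, MeasurableEquiv.piFinSuccAbove, Fin.insertNthEquiv, Fin.tail,
      le_sub_iff_add_le]
  rw [hpre, hmp.measure_preimage hS.nullMeasurableSet, Measure.prod_apply_symm hS]
  simp

theorem chiSquaredCDF_antitone (υ : ℝ) (k : ℕ) : Antitone (chiSquaredCDF υ k) := by
  intro ψ ψ' h
  rw [chiSquaredCDF, chiSquaredCDF, cdf_eq_real, cdf_eq_real]
  refine ENNReal.toReal_mono (measure_ne_top _ _) ?_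
  cases k with
  -- With no coordinates the law does not depend on `ψ`.
  | zero => simp [noncentralChiSquared]
  | succ k =>
    rw [noncentralChiSquared_Iic_succ, noncentralChiSquared_Iic_succ]
    exact lintegral_mono fun w =>
      gaussianReal_sq_le_antitone (Real.sqrt_nonneg _) (Real.sqrt_le_sqrt h) _

end Probability

/-! ### The smallest eigenvalue of a Gram matrix. -/

section Eigenvalue

variable {t d : ℕ} (X : Matrix (Fin t) (Fin d) ℝ)

theorem isHermitian_transpose_mul_self : (Xᵀ * X).IsHermitian := by
  simpa using Matrix.isHermitian_conjTranspose_mul_self X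

theorem posSemidef_transpose_mul_self : (Xᵀ * X).PosSemidef := by
  simpa using Matrix.posSemidef_conjTranspose_mul_self X

theorem minEigenvalue_pos (hd : 0 < d) (hX : X.rank = d) : 0 < minEigenvalue (Xᵀ * X) := by
  have hH := isHermitian_transpose_mul_self X
  -- The infimum is attained because the spectrum is finite and nonempty; for `d = 0` it would be
  -- `sInf ∅ = 0`.
  have : Nonempty (Fin d) := ⟨⟨0, hd⟩⟩
  have hmem : minEigenvalue (Xᵀ * X) ∈ Set.range hH.eigenvalues := by
    rw [minEigenvalue, hH.spectrum_real_eq_range_eigenvalues]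
    exact (Set.range_nonempty _).csInf_mem (Set.finite_range _)
  obtain ⟨i, hi⟩ := hmem
  rw [← hi]
  refine lt_of_le_of_ne ((posSemidef_transpose_mul_self X).eigenvalues_nonneg i) (Ne.symm ?_)
  have hr := hH.rank_eq_card_non_zero_eigs
  rw [Matrix.rank_transpose_mul_self, hX] at hr
  by_contra h0
  have := Fintype.card_subtype_lt (p := fun i => hH.eigenvalues i ≠ 0) (x := i) (by simpa using h0)
  rw [Fintype.card_fin] at this
  omega

/-- Subtracting the smallest eigenvalue times the identity shifts the spectrum into `[0, ∞)`,
leaving a positive semidefinite matrix. -/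
theorem minEigenvalue_mul_sqNorm_le (v : Fin d → ℝ) :
    minEigenvalue (Xᵀ * X) * sqNorm v ≤ sqNorm (X *ᵥ v) := by
  have hH := isHermitian_transpose_mul_self X
  have hfin : (spectrum ℝ (Xᵀ * X)).Finite := by
    rw [hH.spectrum_real_eq_range_eigenvalues]; exact Set.finite_range _
  have hps : (Xᵀ * X - algebraMap ℝ _ (minEigenvalue (Xᵀ * X))).PosSemidef := by
    rw [Matrix.posSemidef_iff_isHermitian_and_spectrum_nonneg]
    refine ⟨hH.sub ?_, ?_⟩
    · rw [Matrix.algebraMap_eq_diagonal]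
      exact Matrix.isHermitian_diagonal _
    · rw [← spectrum.sub_singleton_eq]
      rintro _ ⟨a, ha, b, rfl, rfl⟩
      exact sub_nonneg.2 (csInf_le hfin.bddBelow ha)
  have := hps.dotProduct_mulVec_nonneg v
  rw [Algebra.algebraMap_eq_smul_one, Matrix.sub_mulVec, Matrix.smul_mulVec, Matrix.one_mulVec,
    dotProduct_sub, dotProduct_smul, star_trivial, ← Matrix.mulVec_mulVec, Matrix.dotProduct_mulVec,
    Matrix.vecMul_transpose, smul_eq_mul] at this
  rw [sqNorm_eq_dotProduct, sqNorm_eq_dotProduct]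
  linarith

end Eigenvalue

/-! ### The projection behind the statistic, its rank, and the bound on `ψ`. -/

section Projection

variable {t₁ t₂ d : ℕ} {X₁ : Matrix (Fin t₁) (Fin d) ℝ} {X₂ : Matrix (Fin t₂) (Fin d) ℝ}
  {G₁ G₂ G₁₂ : Matrix (Fin d) (Fin d) ℝ}

/-- The difference between the orthogonal projections onto `range X₁ × range X₂` and onto the range
of the stacked matrix. -/
noncomputable def projectionDifference (X₁ : Matrix (Fin t₁) (Fin d) ℝ)
    (X₂ : Matrix (Fin t₂) (Fin d) ℝ) (G₁ G₂ G₁₂ : Matrix (Fin d) (Fin d) ℝ) :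
    Matrix (Fin t₁ ⊕ Fin t₂) (Fin t₁ ⊕ Fin t₂) ℝ :=
  Matrix.fromBlocks (X₁ * G₁ * X₁ᵀ) 0 0 (X₂ * G₂ * X₂ᵀ) -
    Matrix.fromRows X₁ X₂ * G₁₂ * (Matrix.fromRows X₁ X₂)ᵀ

theorem transpose_fromRows_mul_fromRows (X₁ : Matrix (Fin t₁) (Fin d) ℝ)
    (X₂ : Matrix (Fin t₂) (Fin d) ℝ) :
    (Matrix.fromRows X₁ X₂)ᵀ * Matrix.fromRows X₁ X₂ = X₁ᵀ * X₁ + X₂ᵀ * X₂ := by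
  rw [Matrix.transpose_fromRows, Matrix.fromCols_mul_fromRows]

theorem testStatistic_eq (σ : ℝ) (y₁ : Fin t₁ → ℝ) (y₂ : Fin t₂ → ℝ) :
    testStatistic σ X₁ X₂ G₁ G₂ G₁₂ y₁ y₂ =
      sqNorm (projectionDifference X₁ X₂ G₁ G₂ G₁₂ *ᵥ Sum.elim y₁ y₂) / σ ^ 2 := by
  rw [testStatistic, ← sqNorm_sumElim]
  congr 2
  simp only [estimator, projectionDifference, Matrix.sub_mulVec, Matrix.mulVec_sub,
    Matrix.fromBlocks_mulVec, Matrix.mulVec_mulVec, Matrix.mul_assoc, Matrix.fromRows_mul,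
    Matrix.fromRows_mulVec]
  ext (i | i) <;> simp

theorem isGeneralizedInverse_fromRows
    (hG₁₂ : IsGeneralizedInverse (X₁ᵀ * X₁ + X₂ᵀ * X₂) G₁₂) :
    IsGeneralizedInverse ((Matrix.fromRows X₁ X₂)ᵀ * Matrix.fromRows X₁ X₂) G₁₂ := by
  rwa [transpose_fromRows_mul_fromRows]

theorem projectionDifference_transpose (hG₁ : IsGeneralizedInverse (X₁ᵀ * X₁) G₁)
    (hG₂ : IsGeneralizedInverse (X₂ᵀ * X₂) G₂)
    (hG₁₂ : IsGeneralizedInverse (X₁ᵀ * X₁ + X₂ᵀ * X₂) G₁₂) :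
    (projectionDifference X₁ X₂ G₁ G₂ G₁₂)ᵀ = projectionDifference X₁ X₂ G₁ G₂ G₁₂ := by
  rw [projectionDifference, Matrix.transpose_sub, Matrix.fromBlocks_transpose,
    hG₁.transpose_mul_transpose, hG₂.transpose_mul_transpose,
    (isGeneralizedInverse_fromRows hG₁₂).transpose_mul_transpose]
  simp

/-- The block projection `D` fixes the columns of the stacked matrix, so it absorbs the pooled
projection from the left and, by transposing, from the right. -/
theorem projectionDifference_mul_self (hG₁ : IsGeneralizedInverse (X₁ᵀ * X₁) G₁)
    (hG₂ : IsGeneralizedInverse (X₂ᵀ * X₂) G₂)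
    (hG₁₂ : IsGeneralizedInverse (X₁ᵀ * X₁ + X₂ᵀ * X₂) G₁₂) :
    projectionDifference X₁ X₂ G₁ G₂ G₁₂ * projectionDifference X₁ X₂ G₁ G₂ G₁₂ =
      projectionDifference X₁ X₂ G₁ G₂ G₁₂ := by
  have h := isGeneralizedInverse_fromRows hG₁₂
  have hs := projectionDifference_transpose hG₁ hG₂ hG₁₂
  unfold projectionDifference at *
  set D := Matrix.fromBlocks (X₁ * G₁ * X₁ᵀ) 0 0 (X₂ * G₂ * X₂ᵀ) with hD
  set X := Matrix.fromRows X₁ X₂ with hX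
  have hDD : D * D = D := by
    rw [hD, Matrix.fromBlocks_multiply, ← Matrix.mul_assoc (X₁ * G₁ * X₁ᵀ),
      ← Matrix.mul_assoc (X₁ * G₁ * X₁ᵀ), hG₁.mul_mul_transpose_mul_self,
      ← Matrix.mul_assoc (X₂ * G₂ * X₂ᵀ), ← Matrix.mul_assoc (X₂ * G₂ * X₂ᵀ),
      hG₂.mul_mul_transpose_mul_self]
    simp
  have hDX : D * X = X := by
    rw [hD, hX, Matrix.fromBlocks_mul_fromRows, hG₁.mul_mul_transpose_mul_self,
      hG₂.mul_mul_transpose_mul_self]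
    simp
  have hDP : D * (X * G₁₂ * Xᵀ) = X * G₁₂ * Xᵀ := by
    rw [← Matrix.mul_assoc, ← Matrix.mul_assoc, hDX]
  have hPP : X * G₁₂ * Xᵀ * (X * G₁₂ * Xᵀ) = X * G₁₂ * Xᵀ := by
    rw [← Matrix.mul_assoc, ← Matrix.mul_assoc, h.mul_mul_transpose_mul_self]
  have hDt : Dᵀ = D := by
    rw [hD, Matrix.fromBlocks_transpose, hG₁.transpose_mul_transpose, hG₂.transpose_mul_transpose]
    simp
  have hPD : X * G₁₂ * Xᵀ * D = X * G₁₂ * Xᵀ := by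
    have := congrArg Matrix.transpose hDP
    rwa [Matrix.transpose_mul, h.transpose_mul_transpose, hDt] at this
  rw [Matrix.sub_mul, Matrix.mul_sub, Matrix.mul_sub, hDD, hDP, hPD, hPP]
  simp

theorem trace_fromBlocks {m n : Type*} [Fintype m] [Fintype n] (A : Matrix m m ℝ)
    (B : Matrix m n ℝ) (C : Matrix n m ℝ) (D : Matrix n n ℝ) :
    (Matrix.fromBlocks A B C D).trace = A.trace + D.trace := by
  simp [Matrix.trace]

theorem rank_projectionDifference (hG₁ : IsGeneralizedInverse (X₁ᵀ * X₁) G₁)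
    (hG₂ : IsGeneralizedInverse (X₂ᵀ * X₂) G₂)
    (hG₁₂ : IsGeneralizedInverse (X₁ᵀ * X₁ + X₂ᵀ * X₂) G₁₂) :
    (projectionDifference X₁ X₂ G₁ G₂ G₁₂).rank = degreesOfFreedom X₁ X₂ := by
  have h := trace_eq_rank_of_isIdempotentElem (projectionDifference_mul_self hG₁ hG₂ hG₁₂)
  rw [projectionDifference, Matrix.trace_sub, trace_fromBlocks, hG₁.trace_eq_rank,
    hG₂.trace_eq_rank, (isGeneralizedInverse_fromRows hG₁₂).trace_eq_rank] at h
  rw [degreesOfFreedom, projectionDifference]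
  -- The trace identity is used in additive form, so truncated subtraction is harmless.
  apply Nat.eq_sub_of_add_eq
  rw [sub_eq_iff_eq_add] at h
  exact_mod_cast h.symm

/-- The block projection fixes the mean vector, since each block `Xᵢ θᵢ` is already in the range of
`Xᵢ`. -/
theorem projectionDifference_mulVec (hG₁ : IsGeneralizedInverse (X₁ᵀ * X₁) G₁)
    (hG₂ : IsGeneralizedInverse (X₂ᵀ * X₂) G₂) (θ₁ θ₂ : Fin d → ℝ) :
    projectionDifference X₁ X₂ G₁ G₂ G₁₂ *ᵥ Sum.elim (X₁ *ᵥ θ₁) (X₂ *ᵥ θ₂) =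
      (1 - Matrix.fromRows X₁ X₂ * G₁₂ * (Matrix.fromRows X₁ X₂)ᵀ) *ᵥ
        Sum.elim (X₁ *ᵥ θ₁) (X₂ *ᵥ θ₂) := by
  rw [projectionDifference, Matrix.sub_mulVec, Matrix.sub_mulVec, Matrix.one_mulVec,
    Matrix.fromBlocks_mulVec]
  congr 2 <;>
  simp [Matrix.mulVec_mulVec, hG₁.mul_mul_transpose_mul_self, hG₂.mul_mul_transpose_mul_self]

theorem noncentrality_eq (hG₁ : IsGeneralizedInverse (X₁ᵀ * X₁) G₁)
    (hG₂ : IsGeneralizedInverse (X₂ᵀ * X₂) G₂)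
    (hG₁₂ : IsGeneralizedInverse (X₁ᵀ * X₁ + X₂ᵀ * X₂) G₁₂) (σ : ℝ)
    (θ₁ θ₂ : EuclideanSpace ℝ (Fin d)) :
    noncentrality σ X₁ X₂ G₁₂ θ₁ θ₂ = sqNorm (projectionDifference X₁ X₂ G₁ G₂ G₁₂ *ᵥ
      Sum.elim (X₁ *ᵥ θ₁.ofLp) (X₂ *ᵥ θ₂.ofLp)) / σ ^ 2 := by
  rw [noncentrality, ← projectionDifference_mulVec hG₁ hG₂, sqNorm_eq_dotProduct]
  congr 1
  conv_lhs => rw [← projectionDifference_mul_self hG₁ hG₂ hG₁₂, ← Matrix.mulVec_mulVec,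
    Matrix.dotProduct_mulVec, ← Matrix.mulVec_transpose,
    projectionDifference_transpose hG₁ hG₂ hG₁₂]

/-- Triangle inequality followed by the weighted Cauchy–Schwarz inequality `(p + q)² ≤ (a p² + b
q²)(1/a + 1/b)`, whose deficit is `(a p - b q)² / (a b)`. -/
theorem sq_norm_sub_div_le {E : Type*} [SeminormedAddCommGroup E] {a b : ℝ} (ha : 0 < a)
    (hb : 0 < b) (x y z : E) :
    ‖x - y‖ ^ 2 / (1 / a + 1 / b) ≤ a * ‖x - z‖ ^ 2 + b * ‖y - z‖ ^ 2 := by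
  have htri : ‖x - y‖ ≤ ‖x - z‖ + ‖y - z‖ := by
    rw [norm_sub_rev y z]; exact norm_sub_le_norm_sub_add_norm_sub x z y
  have h1 : ‖x - y‖ ^ 2 ≤ (‖x - z‖ + ‖y - z‖) ^ 2 := by gcongr
  rw [div_le_iff₀ (by positivity)]
  refine h1.trans ?_
  have h2 : (a * ‖x - z‖ ^ 2 + b * ‖y - z‖ ^ 2) * (1 / a + 1 / b) -
      (‖x - z‖ + ‖y - z‖) ^ 2 = (a * ‖x - z‖ - b * ‖y - z‖) ^ 2 / (a * b) := by
    field_simp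
    ring
  have h3 : 0 ≤ (a * ‖x - z‖ - b * ‖y - z‖) ^ 2 / (a * b) := by positivity
  linarith

theorem le_noncentrality (hG₁ : IsGeneralizedInverse (X₁ᵀ * X₁) G₁)
    (hG₂ : IsGeneralizedInverse (X₂ᵀ * X₂) G₂)
    (hG₁₂ : IsGeneralizedInverse (X₁ᵀ * X₁ + X₂ᵀ * X₂) G₁₂) (σ : ℝ)
    (θ₁ θ₂ : EuclideanSpace ℝ (Fin d)) (hd : 0 < d) (h₁ : X₁.rank = d) (h₂ : X₂.rank = d) :
    (‖θ₁ - θ₂‖ ^ 2 / σ ^ 2) / (1 / minEigenvalue (X₁ᵀ * X₁) + 1 / minEigenvalue (X₂ᵀ * X₂)) ≤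
      noncentrality σ X₁ X₂ G₁₂ θ₁ θ₂ := by
  rw [noncentrality_eq hG₁ hG₂ hG₁₂, div_right_comm]
  gcongr
  rw [projectionDifference_mulVec hG₁ hG₂]
  -- `w` is the pooled fit to the noiseless data; what matters is that both residual blocks share
  -- it.
  set w := (G₁₂ * (Matrix.fromRows X₁ X₂)ᵀ) *ᵥ Sum.elim (X₁ *ᵥ θ₁.ofLp) (X₂ *ᵥ θ₂.ofLp) with hw
  have hsplit : (1 - Matrix.fromRows X₁ X₂ * G₁₂ * (Matrix.fromRows X₁ X₂)ᵀ) *ᵥ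
      Sum.elim (X₁ *ᵥ θ₁.ofLp) (X₂ *ᵥ θ₂.ofLp) =
      Sum.elim (X₁ *ᵥ (θ₁.ofLp - w)) (X₂ *ᵥ (θ₂.ofLp - w)) := by
    rw [Matrix.sub_mulVec, Matrix.one_mulVec, Matrix.mul_assoc, ← Matrix.mulVec_mulVec, ← hw,
      Matrix.fromRows_mulVec]
    ext (i | i) <;> simp [Matrix.mulVec_sub]
  rw [hsplit, sqNorm_sumElim]
  refine (sq_norm_sub_div_le (minEigenvalue_pos X₁ hd h₁) (minEigenvalue_pos X₂ hd h₂) θ₁ θ₂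
    (WithLp.toLp 2 w)).trans ?_
  exact add_le_add (minEigenvalue_mul_sqNorm_le X₁ (θ₁.ofLp - w))
    (minEigenvalue_mul_sqNorm_le X₂ (θ₂.ofLp - w))

theorem degreesOfFreedom_of_rank_eq (h₁ : X₁.rank = d) (h₂ : X₂.rank = d) :
    degreesOfFreedom X₁ X₂ = d := by
  have h : (Matrix.fromRows X₁ X₂).rank = d := by
    refine le_antisymm (by simpa using Matrix.rank_le_card_width (Matrix.fromRows X₁ X₂)) ?_
    let S : Matrix (Fin t₁) (Fin t₁ ⊕ Fin t₂) ℝ := Matrix.fromCols 1 0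
    have h3 : S * Matrix.fromRows X₁ X₂ = X₁ := by
      simp [S, Matrix.fromCols_mul_fromRows]
    calc d = X₁.rank := h₁.symm
      _ = (S * Matrix.fromRows X₁ X₂).rank := by rw [h3]
      _ ≤ _ := Matrix.rank_mul_le_right _ _
  rw [degreesOfFreedom, h₁, h₂, h, Nat.add_sub_cancel]

end Projection

/-! ### Law of a projected Gaussian vector, and the conclusion. -/

theorem hasLaw_sqNorm_mulVec_div {Ω n : Type*} [MeasurableSpace Ω] {P : Measure Ω}
    [IsProbabilityMeasure P] [Fintype n] [DecidableEq n] {σ : ℝ} (hσ : 0 < σ)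
    {μ : n → ℝ} {y : n → Ω → ℝ}
    (hy : ∀ i, HasLaw (y i) (gaussianReal (μ i) (σ ^ 2).toNNReal) P) (hind : iIndepFun y P)
    {Q : Matrix n n ℝ} (hs : Qᵀ = Q) (hi : Q * Q = Q) {k : ℕ} (hk : Q.rank = k) :
    HasLaw (fun ω => sqNorm (Q *ᵥ fun j => y j ω) / σ ^ 2)
      (noncentralChiSquared k (sqNorm (Q *ᵥ μ) / σ ^ 2)) P := by
  obtain ⟨u, hu, hsq, hμ⟩ := exists_orthonormal_sqNorm_mulVec hs hi hk μ
  have hZ := hasLaw_dotProduct_div hσ hy hind hu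
  have hmean : (fun i : Fin k => gaussianReal ((u i ⬝ᵥ μ) / σ) 1) =
      fun i : Fin k => gaussianReal (if (i : ℕ) = 0 then √(sqNorm (Q *ᵥ μ) / σ ^ 2) else 0) 1 := by
    ext1 i
    rw [hμ, Real.sqrt_div (sqNorm_nonneg _), Real.sqrt_sq hσ.le, ite_div, zero_div]
  rw [hmean] at hZ
  have hF : HasLaw (fun z : Fin k → ℝ => ∑ i, z i ^ 2)
      (noncentralChiSquared k (sqNorm (Q *ᵥ μ) / σ ^ 2))
      (Measure.pi fun i : Fin k =>
        gaussianReal (if (i : ℕ) = 0 then √(sqNorm (Q *ᵥ μ) / σ ^ 2) else 0) 1) :=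
    ⟨Measurable.aemeasurable (by fun_prop), rfl⟩
  convert hF.fun_comp hZ using 2 with ω
  simp [hsq, div_pow, Finset.sum_div]

end HomogeneityTest

theorem lemma2 {Ω : Type*} [MeasurableSpace Ω] (P : Measure Ω) [IsProbabilityMeasure P]
    {t₁ t₂ d : ℕ} (σ : ℝ) (hσ : 0 < σ)
    (X₁ : Matrix (Fin t₁) (Fin d) ℝ) (X₂ : Matrix (Fin t₂) (Fin d) ℝ)
    (θ₁ θ₂ : EuclideanSpace ℝ (Fin d)) (hθ : θ₁ ≠ θ₂)
    (y₁ : Fin t₁ → Ω → ℝ) (y₂ : Fin t₂ → Ω → ℝ)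
    (hy₁ : ∀ i, HasLaw (y₁ i) (gaussianReal ((X₁ *ᵥ θ₁.ofLp) i) (σ ^ 2).toNNReal) P)
    (hy₂ : ∀ j, HasLaw (y₂ j) (gaussianReal ((X₂ *ᵥ θ₂.ofLp) j) (σ ^ 2).toNNReal) P)
    (hindep : iIndepFun (Sum.elim y₁ y₂) P)
    (G₁ G₂ G₁₂ : Matrix (Fin d) (Fin d) ℝ)
    (hG₁ : HomogeneityTest.IsGeneralizedInverse (X₁ᵀ * X₁) G₁)
    (hG₂ : HomogeneityTest.IsGeneralizedInverse (X₂ᵀ * X₂) G₂)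
    (hG₁₂ : HomogeneityTest.IsGeneralizedInverse (X₁ᵀ * X₁ + X₂ᵀ * X₂) G₁₂)
    (υ : ℝ) :
    0 ≤ HomogeneityTest.noncentrality σ X₁ X₂ G₁₂ θ₁ θ₂ ∧
    P.real {ω | HomogeneityTest.testStatistic σ X₁ X₂ G₁ G₂ G₁₂
        (fun i => y₁ i ω) (fun j => y₂ j ω) ≤ υ} ≤
      if X₁.rank = d ∧ X₂.rank = d then
        HomogeneityTest.chiSquaredCDF υ d
          ((‖θ₁ - θ₂‖ ^ 2 / σ ^ 2) /
            (1 / HomogeneityTest.minEigenvalue (X₁ᵀ * X₁) +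
              1 / HomogeneityTest.minEigenvalue (X₂ᵀ * X₂)))
      else
        HomogeneityTest.chiSquaredCDF υ (HomogeneityTest.degreesOfFreedom X₁ X₂) 0 := by
  open HomogeneityTest in
  have hψ : 0 ≤ noncentrality σ X₁ X₂ G₁₂ θ₁ θ₂ := by
    rw [noncentrality_eq hG₁ hG₂ hG₁₂]
    exact div_nonneg (sqNorm_nonneg _) (sq_nonneg σ)
  refine ⟨hψ, ?_⟩
  have hlaw := hasLaw_sqNorm_mulVec_div hσ (P := P) (y := Sum.elim y₁ y₂)
    (μ := Sum.elim (X₁ *ᵥ θ₁.ofLp) (X₂ *ᵥ θ₂.ofLp)) (by rintro (i | i); exacts [hy₁ i, hy₂ i])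
    hindep (projectionDifference_transpose hG₁ hG₂ hG₁₂)
    (projectionDifference_mul_self hG₁ hG₂ hG₁₂) (rank_projectionDifference hG₁ hG₂ hG₁₂)
  rw [← noncentrality_eq hG₁ hG₂ hG₁₂] at hlaw
  have hprob : P.real {ω | testStatistic σ X₁ X₂ G₁ G₂ G₁₂
      (fun i => y₁ i ω) (fun j => y₂ j ω) ≤ υ} =
      chiSquaredCDF υ (degreesOfFreedom X₁ X₂) (noncentrality σ X₁ X₂ G₁₂ θ₁ θ₂) := by
    rw [chiSquaredCDF, cdf_eq_real]
    refine Eq.trans ?_ (hlaw.measureReal_eq (p := fun x => x ≤ υ) measurableSet_Iic)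
    congr 1
    ext ω
    have hω : (fun j => Sum.elim y₁ y₂ j ω) = Sum.elim (fun i => y₁ i ω) (fun j => y₂ j ω) := by
      ext (i | i) <;> rfl
    rw [Set.mem_ofPred_eq, Set.mem_ofPred_eq, testStatistic_eq, hω]
  rw [hprob]
  split_ifs with h
  -- Distinct parameters exclude `d = 0`, where the smallest eigenvalues would be meaningless.
  · have hd : 0 < d := by
      rcases Nat.eq_zero_or_pos d with rfl | hd
      · exact absurd (Subsingleton.elim θ₁ θ₂) hθ
      · exact hd
    rw [degreesOfFreedom_of_rank_eq h.1 h.2]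
    exact chiSquaredCDF_antitone υ d (le_noncentrality hG₁ hG₂ hG₁₂ σ θ₁ θ₂ hd h.1 h.2)
  · exact chiSquaredCDF_antitone υ _ hψ
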